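/- Let $N\ge 1$, let $\mathbb B=\{z\in\mathbb C^N:|z|<1\}$ be the unit ball, $\langle z,w\rangle=\sum_j z_j\overline{w_j}$, let $\mu$ be Lebesgue measure on $\mathbb B$ normalized by $\mu(\mathbb B)=1$, and for $q\in\mathbb R$ put $d\mu_q(z)=(1-|z|^2)^q\,d\mu(z)$. For $a\in\mathbb R$ let $$K_a(z,w)=\begin{cases}(1-\langle z,w\rangle)^{-(N+1+a)}, & a>-(N+1),\\ {}_2F_1\bigl(1,1;1-(N+a);\langle z,w\rangle\bigr), & a\le-(N+1),\end{cases}\qquad z,w\in\mathbb B,$$ (principal power), and for $s,t,q\in\mathbb R$ let $$P_{s,t}f(z)=(1-|z|^2)^t\int_{\mathbb B}K_{s+t}(z,w)f(w)(1-|w|^2)^{s-q}\,d\mu_q(w).$$ A weight is a locally integrable function $\omega\ge 0$ on $\mathbb B$. For $1<p<\infty$, $P_{s,t}$ is said to be well defined and continuous from $L^p(\omega\,d\mu_q)$ to $L^p(\omega\,d\mu_Q)$ if, for every measurable $f:\mathbb B\to\mathbb C$ with $\int_{\mathbb B}|f|^p\omega\,d\mu_q<\infty$, the integral defining $P_{s,t}f(z)$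 converges absolutely for $\mu$-almost every $z\in\mathbb B$, and there is a constant $C$ such that $\|P_{s,t}f\|_{L^p(\omega d\mu_Q)}\le C\|f\|_{L^p(\omega d\mu_q)}$ for all such $f$. Theorem. Let $1<p<\infty$, $s>-1$ and $t,q,Q\in\mathbb R$. Suppose that either (i) $s+t+\frac{Q-q}{p}\le-1$ (in particular, if moreover $-(N+1)<s+t<-1$), or (ii) $s+t>-1$ and $Q<q$. Then there is no weight $\omega$ on $\mathbb B$ for which $P_{s,t}$ is well defined and continuous from $L^p(\omega\,d\mu_q)$ to $L^p(\omega\,d\mu_Q)$. -/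

import Mathlib

open MeasureTheory

noncomputable section

namespace BergmanBesov

/-- The space `ℂ^N` with its Euclidean norm. -/
abbrev Cn (N : ℕ) : Type := EuclideanSpace ℂ (Fin N)

/-- The open unit ball of `ℂ^N`. -/
def unitBall (N : ℕ) : Set (Cn N) := Metric.ball 0 1

/-- The product `⟨z, w⟩ = z₁ w̄₁ + ⋯ + z_N w̄_N`, linear in `z`. -/
def pairing {N : ℕ} (z w : Cn N) : ℂ := ∑ j, z j * (starRingEnd ℂ) (w j)

/-- Lebesgue measure on the unit ball, normalized to total mass one. -/
def mu (N : ℕ) : Measure (Cn N) :=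
  (volume (unitBall N))⁻¹ • volume.restrict (unitBall N)

/-- `dμ_q(z) = (1 - |z|²)^q dμ(z)`. -/
def muPow (N : ℕ) (q : ℝ) : Measure (Cn N) :=
  (mu N).withDensity fun z => ENNReal.ofReal ((1 - ‖z‖ ^ 2) ^ q)

/-- The Bergman-Besov kernel `K_a(z, w)`. For `z, w` in the ball, `1 - ⟨z, w⟩` has positive
real part and the complex power is the principal one. -/
def kernel {N : ℕ} (a : ℝ) (z w : Cn N) : ℂ :=
  if -((N : ℝ) + 1) < a then
    1 / (1 - pairing z w) ^ ((((N : ℝ) + 1 + a : ℝ)) : ℂ)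
  else
    ordinaryHypergeometric (1 : ℂ) 1 ((1 - ((N : ℝ) + a) : ℝ) : ℂ) (pairing z w)

/-- The integrand (in `w`, against `dμ_q`) of the operator `P_{s,t}` at the point `z`. -/
def integrandP {N : ℕ} (s t q : ℝ) (f : Cn N → ℂ) (z w : Cn N) : ℂ :=
  kernel (s + t) z w * f w * (((1 - ‖w‖ ^ 2) ^ (s - q) : ℝ) : ℂ)

/-- `P_{s,t} f(z) = (1 - |z|²)^t ∫ K_{s+t}(z, w) f(w) (1 - |w|²)^(s - q) dμ_q(w)`. -/
def opP {N : ℕ} (s t q : ℝ) (f : Cn N → ℂ) (z : Cn N) : ℂ :=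
  (((1 - ‖z‖ ^ 2) ^ t : ℝ) : ℂ) * ∫ w, integrandP s t q f z w ∂(muPow N q)

/-- A weight: a locally integrable nonnegative function on the unit ball. -/
structure IsWeight {N : ℕ} (ω : Cn N → ℝ) : Prop where
  nonneg : ∀ z ∈ unitBall N, 0 ≤ ω z
  locallyIntegrableOn : LocallyIntegrableOn ω (unitBall N)

/-- The measure `ω dμ_q`. -/
def weightedMeasure {N : ℕ} (ω : Cn N → ℝ) (q : ℝ) : Measure (Cn N) :=
  (muPow N q).withDensity fun z => ENNReal.ofReal (ω z)

/-- `P_{s,t}` is well defined and continuous from `L^p(ω dμ_q)` to `L^p(ω dμ_Q)`: for every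
`f` in the first space the defining integral converges absolutely at almost every point of
the ball, and `P_{s,t}` satisfies a norm inequality. -/
structure IsWellDefinedContinuousP {N : ℕ} (s t q Q p : ℝ) (ω : Cn N → ℝ) : Prop where
  wellDefined : ∀ f : Cn N → ℂ, Measurable f →
    MemLp f (ENNReal.ofReal p) (weightedMeasure ω q) →
    ∀ᵐ z ∂(mu N), Integrable (integrandP s t q f z) (muPow N q)
  continuous : ∃ C : NNReal, ∀ f : Cn N → ℂ, Measurable f →
    MemLp f (ENNReal.ofReal p) (weightedMeasure ω q) →
    eLpNorm (opP s t q f) (ENNReal.ofReal p) (weightedMeasure ω Q)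
      ≤ C * eLpNorm f (ENNReal.ofReal p) (weightedMeasure ω q)

end BergmanBesov

end

noncomputable section

namespace BergmanBesov

open Metric Set Filter Topology

variable {N : ℕ}

/-! Both regimes are excluded by testing on indicators.

Regime (i). For `w` in a small ball `B` about the origin the kernel is close to `1` for every `z`,
so `|P 1_B|` is at least a constant times `(1 - |z|²)^t` on the whole ball. Continuity puts `(1 -
|z|²)^t` in `L^p(ω dμ_Q)`, which says that `g = (1 - |z|²)^(t + (Q - q)/p)` lies in `L^p(ω dμ_q)`.
Hence the integral defining `P g` converges absolutely at some `z` near the origin, where `|K| ≥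
1/2` for all `w`, and `g` is integrable against `(1 - |w|²)^s dμ`. This forces `s + t + (Q - q)/p >
-1` (`neg_one_lt_of_isWellDefinedContinuousP`).

Regime (ii). On a nonisotropic polydisc `B` at height `d`, the kernel is close to `d^(-(N+1+s+t))`,
`1 - |z|²` is comparable to `d`, and `μ(B)` is at least a constant times `d^(N+1)`. The powers of
`d` cancel, so `|P 1_B|` is bounded below on `B` uniformly in `d`. Continuity then gives `d^Q ω(B) ≤
const · d^q ω(B)`. Since `ω(B)` is finite and positive it cancels, and small `d` forces `q ≤ Q`
(`le_of_isWellDefinedContinuousP`). Positivity comes from well-definedness: see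
`setLIntegral_weight_ne_zero`. -/

/-! ### The pairing, the ball and its measures. -/

lemma pairing_eq_inner (z w : Cn N) : pairing z w = inner ℂ w z := by
  simp [pairing, PiLp.inner_apply]

lemma norm_pairing_le (z w : Cn N) : ‖pairing z w‖ ≤ ‖z‖ * ‖w‖ := by
  rw [pairing_eq_inner, mul_comm]
  exact norm_inner_le_norm w z

lemma pairing_self (z : Cn N) : pairing z z = ((‖z‖ ^ 2 : ℝ) : ℂ) := by
  rw [pairing_eq_inner, inner_self_eq_norm_sq_to_K]
  simp

lemma mem_unitBall {z : Cn N} : z ∈ unitBall N ↔ ‖z‖ < 1 := by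
  simp [unitBall]

lemma one_sub_norm_sq_pos {z : Cn N} (hz : z ∈ unitBall N) : 0 < 1 - ‖z‖ ^ 2 := by
  have h := mem_unitBall.1 hz
  nlinarith [norm_nonneg z]

lemma measurableSet_unitBall : MeasurableSet (unitBall N) := measurableSet_ball

lemma volume_unitBall_ne_zero : volume (unitBall N) ≠ 0 :=
  (measure_ball_pos volume _ one_pos).ne'

lemma volume_unitBall_ne_top : volume (unitBall N) ≠ ⊤ := measure_ball_lt_top.ne

lemma ae_mu_mem : ∀ᵐ z ∂(mu N), z ∈ unitBall N := by
  unfold mu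
  exact Measure.ae_smul_measure (ae_restrict_mem measurableSet_unitBall) _

lemma mu_ne_zero_of_isOpen {U : Set (Cn N)} (hU : IsOpen U) (hne : U.Nonempty)
    (hsub : U ⊆ unitBall N) : mu N U ≠ 0 := by
  unfold mu
  rw [Measure.smul_apply, Measure.restrict_apply hU.measurableSet,
    inter_eq_self_of_subset_left hsub, smul_eq_mul]
  exact mul_ne_zero (ENNReal.inv_ne_zero.2 volume_unitBall_ne_top) (hU.measure_ne_zero _ hne)

lemma measurable_ofReal_rpow (q : ℝ) :
    Measurable fun z : Cn N => ENNReal.ofReal ((1 - ‖z‖ ^ 2) ^ q) := by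
  fun_prop

lemma ae_muPow_mem (q : ℝ) : ∀ᵐ z ∂(muPow N q), z ∈ unitBall N :=
  (withDensity_absolutelyContinuous (mu N) _).ae_le ae_mu_mem

lemma IsWeight.aemeasurable_mu {ω : Cn N → ℝ} (hω : IsWeight ω) : AEMeasurable ω (mu N) := by
  unfold mu
  exact hω.locallyIntegrableOn.aestronglyMeasurable.aemeasurable.smul_measure _

lemma weightedMeasure_absolutelyContinuous (ω : Cn N → ℝ) (q : ℝ) :
    weightedMeasure ω q ≪ mu N :=
  (withDensity_absolutelyContinuous _ _).trans (withDensity_absolutelyContinuous _ _)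

lemma lintegral_muPow (q : ℝ) (g : Cn N → ENNReal) :
    ∫⁻ z, g z ∂(muPow N q) = ∫⁻ z, ENNReal.ofReal ((1 - ‖z‖ ^ 2) ^ q) * g z ∂(mu N) := by
  unfold muPow
  rw [lintegral_withDensity_eq_lintegral_mul_non_measurable₀ _
    (measurable_ofReal_rpow q).aemeasurable (by simp)]
  rfl

lemma lintegral_weightedMeasure {ω : Cn N → ℝ} (hω : IsWeight ω) (q : ℝ) (g : Cn N → ENNReal) :
    ∫⁻ z, g z ∂(weightedMeasure ω q) =
      ∫⁻ z, ENNReal.ofReal ((1 - ‖z‖ ^ 2) ^ q) * (ENNReal.ofReal (ω z) * g z) ∂(mu N) := by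
  unfold weightedMeasure
  rw [lintegral_withDensity_eq_lintegral_mul_non_measurable₀ _ _ (by simp), lintegral_muPow]
  · rfl
  · exact (hω.aemeasurable_mu.mono_ac (withDensity_absolutelyContinuous _ _)).ennreal_ofReal

/-! ### The kernel near the origin and its consequences. -/

/-- No parameter is a nonpositive integer, so the series neither terminates nor degenerates and its
radius is one. -/
lemma ordinaryHypergeometricSeries_radius_pos {c : ℝ} (hc : 0 < c) :
    0 < (ordinaryHypergeometricSeries ℂ (1 : ℂ) 1 (c : ℂ)).radius := by
  rw [ordinaryHypergeometricSeries_radius_eq_one]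
  · exact one_pos
  · intro k
    refine ⟨fun h => ?_, fun h => ?_, fun h => ?_⟩ <;> have := congrArg Complex.re h <;>
      simp at this <;> have hk : (0 : ℝ) ≤ k := k.cast_nonneg <;> linarith

/-- The kernel is uniformly close to `1` when the product of the norms is small. -/
lemma exists_norm_kernel_sub_one_le (N : ℕ) (a : ℝ) :
    ∃ r : ℝ, 0 < r ∧ r < 1 ∧ ∀ z w : Cn N, ‖z‖ * ‖w‖ < r → ‖kernel a z w - 1‖ ≤ 1 / 2 := by
  obtain ⟨φ, hφ, hφ0, hk⟩ : ∃ φ : ℂ → ℂ, ContinuousAt φ 0 ∧ φ 0 = 1 ∧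
      ∀ z w : Cn N, kernel a z w = φ (pairing z w) := by
    by_cases ha : -((N : ℝ) + 1) < a
    · refine ⟨fun x => 1 / (1 - x) ^ ((((N : ℝ) + 1 + a : ℝ)) : ℂ), ?_, by simp, fun z w => ?_⟩
      · refine ContinuousAt.div continuousAt_const ?_ (by simp)
        exact ContinuousAt.cpow (by fun_prop) continuousAt_const (by simp)
      · simp only [kernel, if_pos ha]
    · refine ⟨ordinaryHypergeometric (1 : ℂ) 1 ((1 - ((N : ℝ) + a) : ℝ) : ℂ), ?_,
        ordinaryHypergeometric_zero _ _ _, fun z w => ?_⟩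
      · have hc : 0 < 1 - ((N : ℝ) + a) := by linarith
        exact ((FormalMultilinearSeries.hasFPowerSeriesOnBall _
          (ordinaryHypergeometricSeries_radius_pos hc)).hasFPowerSeriesAt).continuousAt
      · simp only [kernel, if_neg ha]
  obtain ⟨ε, hε, h⟩ := Metric.continuousAt_iff.1 hφ (1 / 2) (by norm_num)
  refine ⟨min ε (1 / 2), by positivity, (min_le_right _ _).trans_lt (by norm_num),
    fun z w hzw => ?_⟩
  rw [hk, ← hφ0, ← dist_eq_norm]
  refine (h ?_).le
  rw [dist_zero_right]
  exact (norm_pairing_le z w).trans_lt (hzw.trans_le (min_le_left _ _))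

/-- Absolute convergence of the defining integrals forces integrability of `f` against
`dμ_s`. -/
lemma IsWellDefinedContinuousP.lintegral_ne_top {s t q Q p : ℝ} {ω : Cn N → ℝ}
    (h : IsWellDefinedContinuousP s t q Q p ω) {f : Cn N → ℂ} (hf : Measurable f)
    (hfp : MemLp f (ENNReal.ofReal p) (weightedMeasure ω q)) :
    ∫⁻ w, ENNReal.ofReal ((1 - ‖w‖ ^ 2) ^ s) * ‖f w‖ₑ ∂(mu N) ≠ ⊤ := by
  obtain ⟨r, hr0, hr1, hr⟩ := exists_norm_kernel_sub_one_le N (s + t)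
  have hsub : ball (0 : Cn N) r ⊆ unitBall N := ball_subset_ball hr1.le
  have hpos : mu N (ball 0 r) ≠ 0 :=
    mu_ne_zero_of_isOpen isOpen_ball ⟨0, mem_ball_self hr0⟩ hsub
  -- Convergence holds almost everywhere and the small ball has positive measure, so one good point
  -- lies in it.
  obtain ⟨z, hz, hint⟩ : ∃ z ∈ ball (0 : Cn N) r,
      Integrable (integrandP s t q f z) (muPow N q) := by
    by_contra! hcon
    refine hpos (measure_mono_null (fun z hz => ?_) (h.wellDefined f hf hfp))
    exact hcon z hz
  have hle : ∫⁻ w, ENNReal.ofReal ((1 - ‖w‖ ^ 2) ^ s) * ‖f w‖ₑ ∂(mu N) ≤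
      ∫⁻ w, 2 * ‖integrandP s t q f z w‖ₑ ∂(muPow N q) := by
    rw [lintegral_muPow]
    refine lintegral_mono_ae ?_
    filter_upwards [ae_mu_mem] with w hw
    have hpw := one_sub_norm_sq_pos hw
    have hk : ‖kernel (s + t) z w - 1‖ ≤ 1 / 2 := by
      refine hr z w ?_
      have h1 := mem_unitBall.1 hw
      have h2 : ‖z‖ < r := by simpa using hz
      nlinarith [norm_nonneg z, norm_nonneg w]
    have hk2 : 1 / 2 ≤ ‖kernel (s + t) z w‖ := by
      have := norm_sub_norm_le (1 : ℂ) (1 - kernel (s + t) z w)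
      rw [norm_sub_rev 1] at this
      simp at this
      linarith
    have : ENNReal.ofReal ((1 - ‖w‖ ^ 2) ^ s) * ‖f w‖ₑ =
        ENNReal.ofReal ((1 - ‖w‖ ^ 2) ^ q) * ENNReal.ofReal ((1 - ‖w‖ ^ 2) ^ (s - q) * ‖f w‖) := by
      rw [← ofReal_norm, ← ENNReal.ofReal_mul (by positivity), ← ENNReal.ofReal_mul (by positivity),
        ← mul_assoc, ← Real.rpow_add hpw]
      congr 3
      ring
    rw [this]
    gcongr
    rw [← ofReal_norm, show (2 : ENNReal) * _ = ENNReal.ofReal (2 * ‖integrandP s t q f z w‖) by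
      rw [ENNReal.ofReal_mul (by norm_num), ENNReal.ofReal_ofNat]]
    apply ENNReal.ofReal_le_ofReal
    rw [integrandP, norm_mul, norm_mul, Complex.norm_real, Real.norm_of_nonneg (by positivity)]
    have : 0 ≤ ‖f w‖ * (1 - ‖w‖ ^ 2) ^ (s - q) := by positivity
    nlinarith
  refine (hle.trans_lt ?_).ne
  rw [lintegral_const_mul' _ _ (by simp)]
  exact ENNReal.mul_lt_top (by simp) hint.2

/-- Lower bound for the integral of an indicator function over a set on which the kernel is
nearly a positive constant. -/
lemma le_enorm_integral_indicator {s t q A : ℝ} (hA : 0 < A) {B : Set (Cn N)}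
    (hB : MeasurableSet B) {z : Cn N} (hk : ∀ w ∈ B, ‖kernel (s + t) z w - A‖ ≤ A / 2)
    (hint : Integrable (integrandP s t q (B.indicator 1) z) (muPow N q)) :
    ENNReal.ofReal (A / 2) * ∫⁻ w in B, ENNReal.ofReal ((1 - ‖w‖ ^ 2) ^ s) ∂(mu N) ≤
      ‖∫ w, integrandP s t q (B.indicator 1) z w ∂(muPow N q)‖ₑ := by
  -- The real part of the kernel is at least `A / 2` on `B`, so the integral suffers no
  -- cancellation.
  have hre : ∀ w ∈ unitBall N, B.indicator (fun w => A / 2 * (1 - ‖w‖ ^ 2) ^ (s - q)) w ≤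
      (integrandP s t q (B.indicator 1) z w).re := by
    intro w hw
    have hpw := one_sub_norm_sq_pos hw
    by_cases hwB : w ∈ B
    · have h1 := (Complex.abs_re_le_norm _).trans (hk w hwB)
      rw [abs_le] at h1
      simp only [Complex.sub_re, Complex.ofReal_re] at h1
      simp only [integrandP, indicator_of_mem hwB, Pi.one_apply, mul_one, Complex.re_mul_ofReal]
      gcongr
      linarith
    · simp [integrandP, indicator_of_notMem hwB]
  have hnn : 0 ≤ᵐ[muPow N q] fun w => (integrandP s t q (B.indicator 1) z w).re := by
    filter_upwards [ae_muPow_mem q] with w hw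
    refine le_trans ?_ (hre w hw)
    have hpw := one_sub_norm_sq_pos hw
    exact indicator_apply_nonneg fun _ => by positivity
  have hle : ENNReal.ofReal (∫ w, (integrandP s t q (B.indicator 1) z w).re ∂(muPow N q)) ≤
      ‖∫ w, integrandP s t q (B.indicator 1) z w ∂(muPow N q)‖ₑ := by
    rw [← ofReal_norm]
    apply ENNReal.ofReal_le_ofReal
    have := integral_re hint
    simp only [RCLike.re_eq_complex_re] at this
    rw [this]
    exact Complex.re_le_norm _
  refine le_trans ?_ hle
  have hint' : Integrable (fun w => (integrandP s t q (B.indicator 1) z w).re) (muPow N q) :=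
    hint.re
  rw [ofReal_integral_eq_lintegral_ofReal hint' hnn, lintegral_muPow,
    ← lintegral_const_mul' _ _ (by simp), ← lintegral_indicator hB]
  refine lintegral_mono_ae ?_
  filter_upwards [ae_mu_mem] with w hw
  have hpw := one_sub_norm_sq_pos hw
  by_cases hwB : w ∈ B
  · have h1 := hre w hw
    rw [indicator_of_mem hwB] at h1 ⊢
    rw [← ENNReal.ofReal_mul (by positivity)]
    refine le_trans (le_of_eq ?_) (mul_le_mul_right (ENNReal.ofReal_le_ofReal h1) _)
    rw [← ENNReal.ofReal_mul (by positivity), mul_left_comm, ← Real.rpow_add hpw]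
    congr 3
    ring
  · simp [indicator_of_notMem hwB]

/-! ### Divergent integrals at the sphere and at an interior point. -/

lemma integrableOn_unitBall_of_lintegral_mu {g : Cn N → ℝ} (hg : Measurable g)
    (h : ∫⁻ z, ‖g z‖ₑ ∂(mu N) ≠ ⊤) : IntegrableOn g (unitBall N) := by
  refine ⟨hg.aestronglyMeasurable, ?_⟩
  rw [hasFiniteIntegral_iff_enorm, lt_top_iff_ne_top]
  intro htop
  apply h
  rw [mu, lintegral_smul_measure, htop, smul_eq_mul,
    ENNReal.mul_top (ENNReal.inv_ne_zero.2 volume_unitBall_ne_top)]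

lemma nontrivial_Cn (hN : 1 ≤ N) : Nontrivial (Cn N) := by
  have : Nonempty (Fin N) := ⟨⟨0, hN⟩⟩
  infer_instance

/-- On `(1/2, 1)` the function dominates a multiple of `1 / (1 - y)`, as `y ^ n ≥ 2 ^ (-n)` there.
This is the radial part of the integral over the ball. -/
lemma not_integrableOn_Ioo_rpow_mul {e : ℝ} (he : e ≤ -1) (n : ℕ) :
    ¬ IntegrableOn (fun y : ℝ => y ^ n • (1 - y ^ 2) ^ e) (Ioo 0 1) := by
  intro h
  have h1 : IntegrableOn (fun y : ℝ => y ^ n • (1 - y ^ 2) ^ e) (Ioo (1 / 2) 1) :=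
    h.mono_set (Ioo_subset_Ioo_left (by norm_num))
  have h2 : IntegrableOn (fun y : ℝ => (y - 1)⁻¹) (Ioo (1 / 2) 1) := by
    refine Integrable.mono' (h1.const_mul (2 ^ (n + 1))) (by fun_prop) ?_
    filter_upwards [ae_restrict_mem measurableSet_Ioo] with y hy
    obtain ⟨hy1, hy2⟩ := hy
    have hp : 0 < 1 - y := by linarith
    have hq : 0 < 1 - y ^ 2 := by nlinarith
    have hle : (1 - y ^ 2)⁻¹ ≤ (1 - y ^ 2) ^ e := by
      rw [← Real.rpow_neg_one]
      exact Real.rpow_le_rpow_of_exponent_ge hq (by nlinarith) he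
    have hinv : (1 - y)⁻¹ ≤ 2 * (1 - y ^ 2)⁻¹ := by
      rw [← div_eq_mul_inv, inv_eq_one_div, div_le_div_iff₀ hp hq]
      nlinarith
    have hyn : 1 ≤ (2 * y) ^ n := one_le_pow₀ (by linarith)
    rw [norm_inv, Real.norm_eq_abs, abs_sub_comm, abs_of_pos hp]
    calc (1 - y)⁻¹ ≤ 2 * (1 - y ^ 2) ^ e := hinv.trans (by gcongr)
      _ ≤ (2 * y) ^ n * (2 * (1 - y ^ 2) ^ e) := le_mul_of_one_le_left (by positivity) hyn
      _ = 2 ^ (n + 1) * (y ^ n • (1 - y ^ 2) ^ e) := by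
        rw [smul_eq_mul, mul_pow, pow_succ]; ring
  have h3 : IntervalIntegrable (fun y : ℝ => (y - 1)⁻¹) volume (1 / 2) 1 := by
    rwa [intervalIntegrable_iff_integrableOn_Ioo_of_le (by norm_num)]
  rw [intervalIntegrable_sub_inv_iff] at h3
  norm_num at h3

/-- `(1 - |z|²)^e` is not integrable on the ball for `e ≤ -1`. -/
lemma lintegral_rpow_eq_top (hN : 1 ≤ N) {e : ℝ} (he : e ≤ -1) :
    ∫⁻ z, ENNReal.ofReal ((1 - ‖z‖ ^ 2) ^ e) ∂(mu N) = ⊤ := by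
  have := nontrivial_Cn hN
  by_contra h
  have h1 : IntegrableOn (fun z : Cn N => (1 - ‖z‖ ^ 2) ^ e) (unitBall N) := by
    refine integrableOn_unitBall_of_lintegral_mu (by fun_prop) ?_
    convert h using 1
    refine lintegral_congr_ae ?_
    filter_upwards [ae_mu_mem] with z hz
    have hz := one_sub_norm_sq_pos hz
    rw [← ofReal_norm, Real.norm_of_nonneg (by positivity)]
  exact not_integrableOn_Ioo_rpow_mul he _
    ((integrableOn_fun_norm_addHaar volume (f := fun y => (1 - y ^ 2) ^ e)).1 h1)

/-- In polar coordinates about `z₀` the integrand becomes `1 / y`, which diverges at `0`. -/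
lemma lintegral_singular_eq_top (hN : 1 ≤ N) {B : Set (Cn N)} (hB : IsOpen B)
    (hsub : B ⊆ unitBall N) {z₀ : Cn N} (hz₀ : z₀ ∈ B) :
    ∫⁻ z, ‖B.indicator (fun z => ‖z - z₀‖ ^ (-(Module.finrank ℝ (Cn N) : ℝ))) z‖ₑ ∂(mu N) = ⊤ := by
  have := nontrivial_Cn hN
  have hd : 0 < Module.finrank ℝ (Cn N) := Module.finrank_pos
  by_contra h
  have h1 := integrableOn_unitBall_of_lintegral_mu
    (Measurable.indicator (by fun_prop) hB.measurableSet) h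
  obtain ⟨ρ, hρ, hρB⟩ := Metric.isOpen_iff.1 hB z₀ hz₀
  have h2 : IntegrableOn (fun z : Cn N => ‖z - z₀‖ ^ (-(Module.finrank ℝ (Cn N) : ℝ)))
      (ball z₀ ρ) := by
    refine (h1.mono_set (hρB.trans hsub)).congr_fun (fun z hz => ?_) measurableSet_ball
    exact indicator_of_mem (hρB hz) _
  have h3 : IntegrableOn (fun z : Cn N => ‖z‖ ^ (-(Module.finrank ℝ (Cn N) : ℝ)))
      (ball 0 ρ) := by
    have hmp := measurePreserving_add_right (volume : Measure (Cn N)) z₀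
    have := (hmp.integrableOn_comp_preimage (measurableEmbedding_addRight z₀)).2 h2
    convert this using 1
    · ext z; simp
    · ext z; simp [dist_eq_norm]
  rw [integrableOn_fun_norm_addHaar volume
    (f := fun y => y ^ (-(Module.finrank ℝ (Cn N) : ℝ)))] at h3
  have h4 : IntegrableOn (fun y : ℝ => y⁻¹) (Ioo 0 ρ) := by
    refine h3.congr_fun (fun y hy => ?_) measurableSet_Ioo
    have hy : 0 < y := hy.1
    simp only [smul_eq_mul]
    rw [← Real.rpow_natCast, ← Real.rpow_add hy, ← Real.rpow_neg_one, Nat.cast_sub hd]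
    congr 1
    push_cast
    ring
  rw [← intervalIntegrable_iff_integrableOn_Ioo_of_le hρ.le, intervalIntegrable_inv_iff] at h4
  simp [hρ.le, hρ.ne] at h4

/-! ### Weighted measures of sets away from the sphere. -/

lemma setLIntegral_weight_ne_top {ω : Cn N → ℝ} (hω : IsWeight ω) {ρ : ℝ} (hρ : ρ < 1)
    {B : Set (Cn N)} (hsub : B ⊆ closedBall 0 ρ) :
    ∫⁻ z in B, ENNReal.ofReal (ω z) ∂(mu N) ≠ ⊤ := by
  have hc : closedBall (0 : Cn N) ρ ⊆ unitBall N := closedBall_subset_ball hρ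
  have h1 : IntegrableOn ω (closedBall 0 ρ) :=
    (hω.locallyIntegrableOn.mono_set hc).integrableOn_isCompact (isCompact_closedBall 0 ρ)
  have h2 : ∫⁻ z in closedBall 0 ρ, ‖ω z‖ₑ ≠ ⊤ := h1.2.ne
  refine ne_top_of_le_ne_top
    (ENNReal.mul_ne_top (ENNReal.inv_ne_top.2 (volume_unitBall_ne_zero (N := N))) h2) ?_
  calc ∫⁻ z in B, ENNReal.ofReal (ω z) ∂(mu N)
      ≤ ∫⁻ z in closedBall 0 ρ, ENNReal.ofReal (ω z) ∂(mu N) := lintegral_mono_set hsub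
    _ ≤ ∫⁻ z in closedBall 0 ρ, ‖ω z‖ₑ ∂(mu N) :=
        lintegral_mono fun z => Real.ofReal_le_enorm (ω z)
    _ = (volume (unitBall N))⁻¹ * ∫⁻ z in closedBall 0 ρ, ‖ω z‖ₑ := by
        rw [mu, Measure.restrict_smul, lintegral_smul_measure, smul_eq_mul,
          Measure.restrict_restrict measurableSet_closedBall, inter_eq_self_of_subset_left hc]

lemma weightedMeasure_apply {ω : Cn N → ℝ} (hω : IsWeight ω) (q : ℝ) {B : Set (Cn N)}
    (hB : MeasurableSet B) :
    weightedMeasure ω q B =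
      ∫⁻ z in B, ENNReal.ofReal ((1 - ‖z‖ ^ 2) ^ q) * ENNReal.ofReal (ω z) ∂(mu N) := by
  rw [← lintegral_indicator_one hB, lintegral_weightedMeasure hω, ← lintegral_indicator hB]
  refine lintegral_congr fun z => ?_
  by_cases hz : z ∈ B <;> simp [hz]

lemma weightedMeasure_ne_top {ω : Cn N → ℝ} (hω : IsWeight ω) (q : ℝ) {ρ : ℝ} (hρ : ρ < 1)
    {B : Set (Cn N)} (hB : MeasurableSet B) (hsub : B ⊆ closedBall 0 ρ) :
    weightedMeasure ω q B ≠ ⊤ := by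
  rw [weightedMeasure_apply hω q hB]
  refine ne_top_of_le_ne_top (ENNReal.mul_ne_top (ENNReal.ofReal_ne_top (r := 1 + (1 - ρ ^ 2) ^ q))
    (setLIntegral_weight_ne_top hω hρ hsub)) ?_
  rw [← lintegral_const_mul' _ _ ENNReal.ofReal_ne_top]
  refine setLIntegral_mono' hB fun z hz => ?_
  gcongr
  have hz' : ‖z‖ ≤ ρ := by simpa using hsub hz
  have hρ2 : 0 < 1 - ρ ^ 2 := by nlinarith [norm_nonneg z]
  have h1 : 1 - ρ ^ 2 ≤ 1 - ‖z‖ ^ 2 := by gcongr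
  have h0 : 0 < 1 - ‖z‖ ^ 2 := hρ2.trans_le h1
  have h2 : 1 - ‖z‖ ^ 2 ≤ 1 := by nlinarith [sq_nonneg ‖z‖]
  rcases le_total 0 q with hq | hq
  · have := Real.rpow_le_one h0.le h2 hq
    have : 0 ≤ (1 - ρ ^ 2) ^ q := by positivity
    linarith
  · have := Real.rpow_le_rpow_of_nonpos hρ2 h1 hq
    linarith

lemma memLp_indicator_one {ω : Cn N → ℝ} (hω : IsWeight ω) {p q ρ : ℝ} (hρ : ρ < 1)
    {B : Set (Cn N)} (hB : MeasurableSet B) (hsub : B ⊆ closedBall 0 ρ) :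
    MemLp (B.indicator (1 : Cn N → ℂ)) (ENNReal.ofReal p) (weightedMeasure ω q) :=
  memLp_indicator_const _ hB 1 (Or.inr (weightedMeasure_ne_top hω q hρ hB hsub))

/-! ### The necessary condition from a ball about the origin. -/

/-- Continuity forces `s + t + (Q - q) / p > -1`. -/
theorem neg_one_lt_of_isWellDefinedContinuousP (hN : 1 ≤ N) {p s t q Q : ℝ} (hp : 1 < p)
    {ω : Cn N → ℝ} (hω : IsWeight ω) (h : IsWellDefinedContinuousP s t q Q p ω) :
    -1 < s + t + (Q - q) / p := by
  by_contra! hle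
  have hp0 : 0 < p := by linarith
  have hpe0 : ENNReal.ofReal p ≠ 0 := by simpa using hp0
  obtain ⟨r, hr0, hr1, hr⟩ := exists_norm_kernel_sub_one_le N (s + t)
  set B : Set (Cn N) := ball 0 r
  have hB : MeasurableSet B := measurableSet_ball
  have hBr : B ⊆ closedBall 0 r := ball_subset_closedBall
  have hBu : B ⊆ unitBall N := ball_subset_ball hr1.le
  have hf : Measurable (B.indicator (1 : Cn N → ℂ)) := measurable_one.indicator hB
  have hfp := memLp_indicator_one hω (p := p) (q := q) hr1 hB hBr
  obtain ⟨C, hC⟩ := h.continuous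
  have hPf := (hC _ hf hfp).trans_lt (ENNReal.mul_lt_top (by simp) hfp.2)
  have hS : 0 < ENNReal.ofReal (1 / 2) * ∫⁻ w in B, ENNReal.ofReal ((1 - ‖w‖ ^ 2) ^ s) ∂(mu N) := by
    refine ENNReal.mul_pos (by norm_num) ?_
    rw [← pos_iff_ne_zero, setLIntegral_pos_iff (measurable_ofReal_rpow s),
      inter_eq_self_of_subset_right]
    · exact pos_iff_ne_zero.2 (mu_ne_zero_of_isOpen isOpen_ball ⟨0, mem_ball_self hr0⟩ hBu)
    · intro w hw
      have := one_sub_norm_sq_pos (hBu hw)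
      simp only [Function.mem_support, ne_eq, ENNReal.ofReal_eq_zero, not_le]
      positivity
  -- A finite `k` below the lower bound can be inverted without proving that the bound itself is
  -- finite.
  obtain ⟨k, hk0, hkS⟩ := ENNReal.lt_iff_exists_nnreal_btwn.1 hS
  have hk0 : 0 < k := by simpa using hk0
  have hg : eLpNorm (fun z : Cn N => (1 - ‖z‖ ^ 2) ^ t) (ENNReal.ofReal p)
      (weightedMeasure ω Q) < ⊤ := by
    refine lt_of_le_of_lt (eLpNorm_le_nnreal_smul_eLpNorm_of_ae_le_mul (c := k⁻¹)
      (g := opP s t q (B.indicator 1)) ?_ _) (ENNReal.mul_lt_top (by simp) hPf)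
    refine (weightedMeasure_absolutelyContinuous ω Q).ae_le ?_
    filter_upwards [h.wellDefined _ hf hfp, ae_mu_mem] with z hint hz
    have hzp := one_sub_norm_sq_pos hz
    have hlow := le_enorm_integral_indicator (A := 1) one_pos hB (fun w hw => by
      rw [Complex.ofReal_one]
      refine hr z w ?_
      have h1 := mem_unitBall.1 hz
      have h2 : ‖w‖ < r := by simpa [B] using hw
      nlinarith [norm_nonneg z, norm_nonneg w]) hint
    have hlow := hkS.le.trans hlow
    have hlow : (k : ℝ) ≤ ‖∫ w, integrandP s t q (B.indicator 1) z w ∂(muPow N q)‖ := by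
      rwa [enorm_eq_nnnorm, ENNReal.coe_le_coe, ← NNReal.coe_le_coe, coe_nnnorm] at hlow
    rw [← NNReal.coe_le_coe]
    simp only [NNReal.coe_mul, NNReal.coe_inv, coe_nnnorm]
    rw [opP, norm_mul, Complex.norm_real, mul_left_comm]
    refine le_mul_of_one_le_right (norm_nonneg _) ?_
    rw [inv_mul_eq_div, one_le_div (by exact_mod_cast hk0)]
    exact hlow
  -- The exponent is chosen so that `p (t + (Q - q) / p) + q = p t + Q`: the two norms coincide.
  have hg2 : MemLp (fun z : Cn N => (((1 - ‖z‖ ^ 2) ^ (t + (Q - q) / p) : ℝ) : ℂ))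
      (ENNReal.ofReal p) (weightedMeasure ω q) := by
    refine ⟨(by fun_prop : Measurable _).aestronglyMeasurable, ?_⟩
    convert hg using 1
    rw [eLpNorm_eq_lintegral_rpow_enorm_toReal hpe0 (by simp),
      eLpNorm_eq_lintegral_rpow_enorm_toReal hpe0 (by simp), lintegral_weightedMeasure hω,
      lintegral_weightedMeasure hω, ENNReal.toReal_ofReal hp0.le]
    congr 1
    refine lintegral_congr_ae ?_
    filter_upwards [ae_mu_mem] with z hz
    have hzp := one_sub_norm_sq_pos hz
    rw [mul_left_comm, mul_left_comm (ENNReal.ofReal ((1 - ‖z‖ ^ 2) ^ Q))]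
    congr 1
    rw [← ofReal_norm, ← ofReal_norm, Complex.norm_real, Real.norm_of_nonneg (by positivity),
      Real.norm_of_nonneg (by positivity), ENNReal.ofReal_rpow_of_nonneg (by positivity) hp0.le,
      ENNReal.ofReal_rpow_of_nonneg (by positivity) hp0.le, ← ENNReal.ofReal_mul (by positivity),
      ← ENNReal.ofReal_mul (by positivity), ← Real.rpow_mul hzp.le, ← Real.rpow_mul hzp.le,
      ← Real.rpow_add hzp, ← Real.rpow_add hzp]
    congr 2
    field_simp
    ring
  refine h.lintegral_ne_top (by fun_prop) hg2 ?_
  rw [← lintegral_rpow_eq_top hN hle]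
  refine lintegral_congr_ae ?_
  filter_upwards [ae_mu_mem] with z hz
  have hzp := one_sub_norm_sq_pos hz
  rw [← ofReal_norm, Complex.norm_real, Real.norm_of_nonneg (by positivity),
    ← ENNReal.ofReal_mul (by positivity), ← Real.rpow_add hzp, add_assoc]

/-! ### Nonisotropic polydiscs and the kernel on them. -/

/-- The radii of the nonisotropic polydisc: `ε d` in the direction `j₀`, `ε √d` in the others. -/
def boxRadius (j₀ : Fin N) (ε d : ℝ) (j : Fin N) : ℝ := ε * √d * if j = j₀ then √d else 1

/-- The polydisc centered at `r e_{j₀}` whose shape is that of a small Bergman ball. -/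
def box (j₀ : Fin N) (ε r : ℝ) : Set (Cn N) :=
  {z | ∀ j, ‖z j - (if j = j₀ then (r : ℂ) else 0)‖ < boxRadius j₀ ε (1 - r ^ 2) j}

lemma isOpen_box (j₀ : Fin N) (ε r : ℝ) : IsOpen (box j₀ ε r) := by
  simp only [box, ofPred_forall]
  exact isOpen_iInter_of_finite fun j => isOpen_lt (by fun_prop) continuous_const

lemma single_mem_box (j₀ : Fin N) {ε r : ℝ} (hε : 0 < ε) (hr : 0 < 1 - r ^ 2) :
    EuclideanSpace.single j₀ (r : ℂ) ∈ box j₀ ε r := by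
  intro j
  have : 0 < √(1 - r ^ 2) := Real.sqrt_pos.2 hr
  by_cases hj : j = j₀
  · subst hj; simp [boxRadius]; positivity
  · simp [boxRadius, hj]; positivity

/-- By uniqueness of Haar measure. The value of the constant is immaterial, since only the order of
growth in `d` is used. -/
lemma exists_volume_eq_smul_pi (N : ℕ) : ∃ c : ENNReal, c ≠ 0 ∧
    ∀ S : Set (Fin N → ℂ), MeasurableSet S →
      volume ((fun z : Cn N => (fun j => z j)) ⁻¹' S) = c * volume S := by
  let e : Cn N ≃L[ℝ] (Fin N → ℂ) :=
    PiLp.continuousLinearEquiv 2 ℝ (fun _ : Fin N => ℂ)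
  have : ((volume : Measure (Cn N)).map e).IsAddHaarMeasure := e.isAddHaarMeasure_map volume
  have he := Measure.isAddLeftInvariant_eq_smul ((volume : Measure (Cn N)).map e) volume
  have hc : Measure.addHaarScalarFactor ((volume : Measure (Cn N)).map e) volume ≠ 0 :=
    (Measure.addHaarScalarFactor_pos_of_isAddHaarMeasure _ _).ne'
  refine ⟨_, ENNReal.coe_ne_zero.2 hc, fun S hS => ?_⟩
  have h := congrArg (fun m : Measure (Fin N → ℂ) => m S) he
  simp only [Measure.map_apply e.continuous.measurable hS, Measure.smul_apply] at h
  rw [ENNReal.smul_def, smul_eq_mul] at h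
  rw [← h]
  rfl

/-- A complex disc has area proportional to its squared radius: each coordinate contributes a factor
`d`, and the direction `j₀` one more. -/
lemma prod_boxRadius (j₀ : Fin N) (ε : ℝ) {d : ℝ} (hd : 0 ≤ d) :
    ∏ j, boxRadius j₀ ε d j ^ 2 = ε ^ (2 * N) * d ^ (N + 1) := by
  simp only [boxRadius, Finset.prod_pow, Finset.prod_mul_distrib, Finset.prod_const,
    Finset.prod_ite_eq', Finset.mem_univ, if_true, Finset.card_univ,
    Fintype.card_fin]
  rw [mul_pow, mul_pow, Real.sq_sqrt hd, ← pow_mul, ← pow_mul, mul_comm N 2, pow_mul √d,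
    Real.sq_sqrt hd, pow_succ]
  ring

/-- The polydiscs have measure comparable to `d ^ (N + 1)`. -/
lemma exists_le_mu_box (j₀ : Fin N) {ε : ℝ} (hε : 0 < ε) : ∃ c : ℝ, 0 < c ∧
    ∀ r : ℝ, 0 < 1 - r ^ 2 → box j₀ ε r ⊆ unitBall N →
      ENNReal.ofReal (c * (1 - r ^ 2) ^ (N + 1)) ≤ mu N (box j₀ ε r) := by
  obtain ⟨c, hc, hvol⟩ := exists_volume_eq_smul_pi N
  have hpos : 0 < (volume (unitBall N))⁻¹ * (c * NNReal.pi ^ N * ENNReal.ofReal (ε ^ (2 * N))) := by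
    refine pos_iff_ne_zero.2 (mul_ne_zero (ENNReal.inv_ne_zero.2 volume_unitBall_ne_top)
      (mul_ne_zero (mul_ne_zero hc (pow_ne_zero _ ?_)) ?_))
    · simpa using NNReal.pi_ne_zero
    · simpa using pow_pos hε _
  obtain ⟨k, hk0, hk⟩ := ENNReal.lt_iff_exists_nnreal_btwn.1 hpos
  refine ⟨k, by simpa using hk0, fun r hr hsub => ?_⟩
  have hbox : box j₀ ε r = (fun z : Cn N => (fun j => z j)) ⁻¹' Set.pi univ fun j =>
      ball (if j = j₀ then (r : ℂ) else 0) (boxRadius j₀ ε (1 - r ^ 2) j) := by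
    ext z
    simp [box, dist_eq_norm]
  have hR : ∀ j, 0 ≤ boxRadius j₀ ε (1 - r ^ 2) j := fun j => by
    unfold boxRadius; split_ifs <;> positivity
  have hv : volume (box j₀ ε r) =
      c * NNReal.pi ^ N * ENNReal.ofReal (ε ^ (2 * N)) * ENNReal.ofReal ((1 - r ^ 2) ^ (N + 1)) := by
    rw [hbox, hvol _ (MeasurableSet.univ_pi fun j => measurableSet_ball), volume_pi_pi]
    simp only [Complex.volume_ball, Finset.prod_mul_distrib, Finset.prod_const, Finset.card_univ,
      Fintype.card_fin]
    rw [mul_assoc _ (ENNReal.ofReal _), ← ENNReal.ofReal_mul (by positivity), ← prod_boxRadius j₀ ε hr.le,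
      ENNReal.ofReal_prod_of_nonneg (fun j _ => sq_nonneg _)]
    simp only [ENNReal.ofReal_pow (hR _)]
    ring
  rw [mu, Measure.smul_apply, Measure.restrict_apply (isOpen_box _ _ _).measurableSet,
    inter_eq_self_of_subset_left hsub, hv, smul_eq_mul, ENNReal.ofReal_mul k.coe_nonneg, ← mul_assoc]
  gcongr
  simpa using hk.le

/-- On the polydisc `1 - ⟨z, w⟩` is close to `d`. -/
lemma norm_one_sub_pairing_sub_le {j₀ : Fin N} {ε r : ℝ} (hε : 0 < ε) (hε1 : ε ≤ 1)
    (hr0 : 0 ≤ r) (hr1 : r < 1) {z w : Cn N} (hz : z ∈ box j₀ ε r) (hw : w ∈ box j₀ ε r) :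
    ‖(1 - pairing z w) - ((1 - r ^ 2 : ℝ) : ℂ)‖ ≤ 3 * N * ε * (1 - r ^ 2) := by
  set d := 1 - r ^ 2 with hd
  have hd0 : 0 < d := by nlinarith
  have hd1 : d ≤ 1 := by nlinarith
  have hterm : ∀ j, ‖z j * (starRingEnd ℂ) (w j) - (if j = j₀ then (r : ℂ) ^ 2 else 0)‖ ≤
      3 * ε * d := by
    intro j
    have hzj := hz j
    have hwj := hw j
    by_cases hj : j = j₀
    · simp only [boxRadius, hj, if_true, mul_assoc, ← hd, Real.mul_self_sqrt hd0.le] at hzj hwj ⊢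
      have hw' : ‖(starRingEnd ℂ) (w j₀) - r‖ < ε * d := by
        rw [← Complex.conj_ofReal, ← map_sub, RCLike.norm_conj]; exact hwj
      have hrn : ‖(r : ℂ)‖ ≤ 1 := by
        rw [Complex.norm_real, Real.norm_of_nonneg hr0]; exact hr1.le
      have hwn : ‖(starRingEnd ℂ) (w j₀)‖ ≤ 2 := by
        have := norm_add_le ((starRingEnd ℂ) (w j₀) - r) (r : ℂ)
        rw [sub_add_cancel] at this
        nlinarith
      calc ‖z j₀ * (starRingEnd ℂ) (w j₀) - (r : ℂ) ^ 2‖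
          = ‖(z j₀ - r) * (starRingEnd ℂ) (w j₀) + r * ((starRingEnd ℂ) (w j₀) - r)‖ := by
            congr 1; ring
        _ ≤ ‖z j₀ - r‖ * ‖(starRingEnd ℂ) (w j₀)‖ + ‖(r : ℂ)‖ * ‖(starRingEnd ℂ) (w j₀) - r‖ := by
            refine (norm_add_le _ _).trans ?_
            rw [norm_mul, norm_mul]
        _ ≤ (ε * d) * 2 + 1 * (ε * d) := by gcongr
        _ = 3 * (ε * d) := by ring
    · simp only [boxRadius, hj, if_false, sub_zero, mul_one, ← hd] at hzj hwj ⊢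
      rw [norm_mul, RCLike.norm_conj]
      calc ‖z j‖ * ‖w j‖ ≤ (ε * √d) * (ε * √d) := by gcongr
        _ = ε * ε * d := by rw [mul_mul_mul_comm, Real.mul_self_sqrt hd0.le]
        _ ≤ 3 * ε * d := by gcongr; linarith
  have hsum : (1 - pairing z w) - ((d : ℝ) : ℂ) =
      -∑ j, (z j * (starRingEnd ℂ) (w j) - (if j = j₀ then (r : ℂ) ^ 2 else 0)) := by
    rw [Finset.sum_sub_distrib, Finset.sum_ite_eq', if_pos (Finset.mem_univ _), hd, pairing]
    push_cast
    ring
  rw [hsum, norm_neg]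
  refine (norm_sum_le _ _).trans ((Finset.sum_le_sum fun j _ => hterm j).trans (le_of_eq ?_))
  simp
  ring

/-- A positive real factor does not change the argument, so the principal power splits. -/
lemma one_div_ofReal_mul_cpow {d : ℝ} (hd : 0 < d) {y : ℂ} (hy : y ≠ 0) (b : ℝ) :
    1 / ((d : ℂ) * y) ^ (b : ℂ) = ((d ^ (-b) : ℝ) : ℂ) * (1 / y ^ (b : ℂ)) := by
  have hd' : (d : ℂ) ≠ 0 := by exact_mod_cast hd.ne'
  rw [Complex.cpow_def_of_ne_zero (mul_ne_zero hd' hy), Complex.log_ofReal_mul hd hy, add_mul,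
    Complex.exp_add, Complex.ofReal_log hd.le, ← Complex.cpow_def_of_ne_zero hd',
    ← Complex.cpow_def_of_ne_zero hy, Real.rpow_neg hd.le, Complex.ofReal_inv,
    Complex.ofReal_cpow hd.le]
  field_simp

/-- On sufficiently small polydiscs the kernel is close to `d ^ (-(N + 1 + a))` and `1 - |z|²`
is comparable to `d`. -/
lemma exists_box_estimates (hN : 1 ≤ N) (j₀ : Fin N) {a : ℝ} (ha : -((N : ℝ) + 1) < a) :
    ∃ ε : ℝ, 0 < ε ∧ ∀ r : ℝ, 0 ≤ r → r < 1 →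
      (∀ z ∈ box j₀ ε r, ∀ w ∈ box j₀ ε r,
        ‖kernel a z w - (((1 - r ^ 2) ^ (-((N : ℝ) + 1 + a)) : ℝ) : ℂ)‖ ≤
          (1 - r ^ 2) ^ (-((N : ℝ) + 1 + a)) / 2) ∧
      ∀ z ∈ box j₀ ε r, (1 - r ^ 2) / 2 ≤ 1 - ‖z‖ ^ 2 ∧ 1 - ‖z‖ ^ 2 ≤ 2 * (1 - r ^ 2) := by
  set b : ℝ := (N : ℝ) + 1 + a
  have hcont : ContinuousAt (fun y : ℂ => 1 / y ^ (b : ℂ)) 1 := by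
    refine ContinuousAt.div continuousAt_const ?_ (by simp)
    exact ContinuousAt.cpow continuousAt_id continuousAt_const (by simp)
  obtain ⟨δ, hδ, hδ'⟩ := Metric.continuousAt_iff.1 hcont (1 / 2) (by norm_num)
  have hN0 : (0 : ℝ) < N := by exact_mod_cast hN
  -- The bound by `δ / 2` controls the kernel; the bound by `1 / 2` keeps `y` away from `0` and
  -- makes `1 - ‖z‖ ^ 2` comparable to `d`.
  set η := min (δ / 2) (1 / 2) with hη
  have hη0 : 0 < η := by positivity
  have hηδ : η < δ := (min_le_left _ _).trans_lt (by linarith)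
  have hη2 : η ≤ 1 / 2 := min_le_right _ _
  have hN1 : (1 : ℝ) ≤ N := by exact_mod_cast hN
  have hεle : η / (3 * N) ≤ 1 := by
    rw [div_le_one (by positivity)]; linarith
  refine ⟨η / (3 * N), by positivity, fun r hr0 hr1 => ?_⟩
  have hd0 : 0 < 1 - r ^ 2 := by nlinarith
  have key : ∀ z ∈ box j₀ (η / (3 * N)) r, ∀ w ∈ box j₀ (η / (3 * N)) r,
      ‖(1 - pairing z w) - ((1 - r ^ 2 : ℝ) : ℂ)‖ ≤ η * (1 - r ^ 2) := fun z hz w hw => by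
    refine (norm_one_sub_pairing_sub_le (by positivity) hεle hr0 hr1 hz hw).trans (le_of_eq ?_)
    field_simp
  set d := 1 - r ^ 2
  have hdc : (d : ℂ) ≠ 0 := by exact_mod_cast hd0.ne'
  refine ⟨fun z hz w hw => ?_, fun z hz => ?_⟩
  · set y : ℂ := (1 - pairing z w) / d with hy
    have hyd : 1 - pairing z w = d * y := by rw [hy]; field_simp
    have hy1 : ‖y - 1‖ ≤ η := by
      have h := key z hz w hw
      rw [hyd, show (d : ℂ) * y - d = d * (y - 1) by ring, norm_mul, Complex.norm_real,
        Real.norm_of_nonneg hd0.le, mul_comm] at h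
      exact le_of_mul_le_mul_right h hd0
    have hy0 : y ≠ 0 := by
      rintro h0
      rw [h0] at hy1
      norm_num at hy1
      linarith
    have hφ := hδ' (x := y) (by rw [dist_eq_norm]; exact hy1.trans_lt hηδ)
    rw [dist_eq_norm, Complex.one_cpow, div_one] at hφ
    rw [kernel, if_pos ha, hyd, one_div_ofReal_mul_cpow hd0 hy0, ← mul_sub_one, norm_mul,
      Complex.norm_real, Real.norm_of_nonneg (by positivity), div_eq_mul_one_div (d ^ (-b))]
    gcongr
  · have h := key z hz z hz
    rw [pairing_self, ← Complex.ofReal_one, ← Complex.ofReal_sub, ← Complex.ofReal_sub,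
      Complex.norm_real, Real.norm_eq_abs, abs_le] at h
    constructor <;> nlinarith

lemma rpow_comparable {x d : ℝ} (hd : 0 < d) (h1 : d / 2 ≤ x) (h2 : x ≤ 2 * d) (e : ℝ) :
    2 ^ (-|e|) * d ^ e ≤ x ^ e ∧ x ^ e ≤ 2 ^ |e| * d ^ e := by
  have hx : 0 < x := by linarith
  rcases le_total 0 e with he | he
  · rw [abs_of_nonneg he, Real.rpow_neg (by norm_num), ← Real.inv_rpow (by norm_num),
      ← Real.mul_rpow (by norm_num) hd.le, ← Real.mul_rpow (by norm_num) hd.le]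
    exact ⟨Real.rpow_le_rpow (by positivity) (by linarith) he, Real.rpow_le_rpow hx.le h2 he⟩
  · rw [abs_of_nonpos he, neg_neg, Real.rpow_neg (by norm_num), ← Real.inv_rpow (by norm_num),
      ← Real.mul_rpow (by norm_num) hd.le, ← Real.mul_rpow (by norm_num) hd.le]
    exact ⟨Real.rpow_le_rpow_of_nonpos hx h2 he,
      Real.rpow_le_rpow_of_nonpos (by positivity) (by linarith) he⟩

/-! ### Testing on polydiscs. -/

/-- A weight for which the operator is well defined has positive mass on every nonempty open
subset of the ball. -/
lemma setLIntegral_weight_ne_zero (hN : 1 ≤ N) {p s t q Q : ℝ} {ω : Cn N → ℝ} (hω : IsWeight ω)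
    (h : IsWellDefinedContinuousP s t q Q p ω) {B : Set (Cn N)} (hB : IsOpen B)
    (hsub : B ⊆ unitBall N) {z₀ : Cn N} (hz₀ : z₀ ∈ B) :
    ∫⁻ z in B, ENNReal.ofReal (ω z) ∂(mu N) ≠ 0 := by
  intro h0
  rw [lintegral_eq_zero_iff' hω.aemeasurable_mu.ennreal_ofReal.restrict] at h0
  have hW : weightedMeasure ω q B = 0 := by
    rw [weightedMeasure_apply hω q hB.measurableSet]
    refine (lintegral_congr_ae ?_).trans lintegral_zero
    filter_upwards [h0] with z hz
    rw [hz]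
    simp
  set n : ℝ := -(Module.finrank ℝ (Cn N) : ℝ)
  -- If `ω` had no mass on `B`, this function would be zero in `L^p(ω dμ_q)`, yet its integral
  -- against `dμ_s` diverges at `z₀`.
  let f : Cn N → ℂ := B.indicator fun z => (((1 - ‖z‖ ^ 2) ^ (-s) * ‖z - z₀‖ ^ n : ℝ) : ℂ)
  have hf : Measurable f := Measurable.indicator (by fun_prop) hB.measurableSet
  have hf0 : f =ᵐ[weightedMeasure ω q] 0 := by
    filter_upwards [measure_eq_zero_iff_ae_notMem.1 hW] with z hz
    exact indicator_of_notMem hz _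
  refine h.lintegral_ne_top hf ((memLp_congr_ae hf0).2 MemLp.zero) ?_
  rw [← lintegral_singular_eq_top hN hB hsub hz₀]
  refine lintegral_congr fun z => ?_
  by_cases hz : z ∈ B
  · have hzp := one_sub_norm_sq_pos (hsub hz)
    simp only [f, indicator_of_mem hz]
    rw [← ofReal_norm, ← ofReal_norm, Complex.norm_real, Real.norm_of_nonneg (by positivity),
      Real.norm_of_nonneg (by positivity), ← ENNReal.ofReal_mul (by positivity), ← mul_assoc,
      ← Real.rpow_add hzp, add_neg_cancel, Real.rpow_zero, one_mul]
  · simp [f, indicator_of_notMem hz]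

/-- Test functions `1_B` on polydiscs are not shrunk on `B` by more than a fixed factor. -/
lemma le_enorm_opP_indicator {s t q c d : ℝ} (hd : 0 < d) {B : Set (Cn N)}
    (hB : MeasurableSet B) (hc : 0 < c) (hmu : ENNReal.ofReal (c * d ^ (N + 1)) ≤ mu N B)
    (hker : ∀ z ∈ B, ∀ w ∈ B, ‖kernel (s + t) z w - ((d ^ (-((N : ℝ) + 1 + (s + t))) : ℝ) : ℂ)‖ ≤
      d ^ (-((N : ℝ) + 1 + (s + t))) / 2)
    (hcomp : ∀ z ∈ B, d / 2 ≤ 1 - ‖z‖ ^ 2 ∧ 1 - ‖z‖ ^ 2 ≤ 2 * d) {z : Cn N} (hz : z ∈ B)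
    (hint : Integrable (integrandP s t q (B.indicator 1) z) (muPow N q)) :
    ENNReal.ofReal (2 ^ (-|t|) * 2 ^ (-|s|) * c / 2) ≤ ‖opP s t q (B.indicator 1) z‖ₑ := by
  set A := d ^ (-((N : ℝ) + 1 + (s + t))) with hAdef
  have hA : 0 < A := by positivity
  have h1 : ENNReal.ofReal (2 ^ (-|s|) * d ^ s) * ENNReal.ofReal (c * d ^ (N + 1)) ≤
      ∫⁻ w in B, ENNReal.ofReal ((1 - ‖w‖ ^ 2) ^ s) ∂(mu N) := by
    refine (mul_le_mul_right hmu _).trans ?_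
    rw [← setLIntegral_const]
    exact setLIntegral_mono' hB fun w hw => ENNReal.ofReal_le_ofReal
      (rpow_comparable hd (hcomp w hw).1 (hcomp w hw).2 s).1
  have h2 := (mul_le_mul_right h1 (ENNReal.ofReal (A / 2))).trans
    (le_enorm_integral_indicator hA hB (hker z hz) hint)
  have h3 : ENNReal.ofReal (2 ^ (-|t|) * d ^ t) ≤ ‖(((1 - ‖z‖ ^ 2) ^ t : ℝ) : ℂ)‖ₑ := by
    rw [← ofReal_norm, Complex.norm_real]
    exact ENNReal.ofReal_le_ofReal ((rpow_comparable hd (hcomp z hz).1 (hcomp z hz).2 t).1.trans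
      (Real.le_norm_self _))
  rw [opP, enorm_mul]
  refine le_trans (le_of_eq ?_) (mul_le_mul' h3 h2)
  rw [← ENNReal.ofReal_mul (by positivity), ← ENNReal.ofReal_mul (by positivity),
    ← ENNReal.ofReal_mul (by positivity)]
  congr 1
  -- The kernel exponent `-(N + 1 + s + t)` exactly balances the two weight factors and the volume.
  have hexp : d ^ t * A * d ^ s * d ^ (N + 1) = 1 := by
    rw [hAdef, ← Real.rpow_natCast, ← Real.rpow_add hd, ← Real.rpow_add hd, ← Real.rpow_add hd]
    push_cast
    ring_nf
    exact Real.rpow_zero d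
  linear_combination -(2 ^ (-|t|) * 2 ^ (-|s|) * c / 2) * hexp

/-- A two-sided estimate of the weighted measure of a set on which `1 - |z|²` is comparable
to `d`. -/
lemma weightedMeasure_comparable {ω : Cn N → ℝ} (hω : IsWeight ω) (q : ℝ) {d : ℝ} (hd : 0 < d)
    {B : Set (Cn N)} (hB : MeasurableSet B)
    (hcomp : ∀ z ∈ B, d / 2 ≤ 1 - ‖z‖ ^ 2 ∧ 1 - ‖z‖ ^ 2 ≤ 2 * d) :
    ENNReal.ofReal (2 ^ (-|q|) * d ^ q) * ∫⁻ z in B, ENNReal.ofReal (ω z) ∂(mu N) ≤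
        weightedMeasure ω q B ∧
      weightedMeasure ω q B ≤
        ENNReal.ofReal (2 ^ |q| * d ^ q) * ∫⁻ z in B, ENNReal.ofReal (ω z) ∂(mu N) := by
  rw [weightedMeasure_apply hω q hB, ← lintegral_const_mul' _ _ ENNReal.ofReal_ne_top,
    ← lintegral_const_mul' _ _ ENNReal.ofReal_ne_top]
  constructor <;> refine setLIntegral_mono' hB fun z hz => ?_ <;> gcongr
  · exact (rpow_comparable hd (hcomp z hz).1 (hcomp z hz).2 q).1
  · exact (rpow_comparable hd (hcomp z hz).1 (hcomp z hz).2 q).2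

/-- A uniform lower bound of `P 1_B` on `B` and the norm inequality compare the two weighted
measures of `B`. -/
lemma weightedMeasure_le_of_le_enorm_opP {s t q Q p : ℝ} (hp : 0 < p) {ω : Cn N → ℝ}
    {C : NNReal} {B : Set (Cn N)} (hB : MeasurableSet B) {k : ℝ} (hk : 0 < k)
    (hC : eLpNorm (opP s t q (B.indicator 1)) (ENNReal.ofReal p) (weightedMeasure ω Q)
      ≤ C * eLpNorm (B.indicator (1 : Cn N → ℂ)) (ENNReal.ofReal p) (weightedMeasure ω q))
    (hlow : ∀ᵐ z ∂(mu N), z ∈ B → ENNReal.ofReal k ≤ ‖opP s t q (B.indicator 1) z‖ₑ) :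
    weightedMeasure ω Q B ≤ ENNReal.ofReal ((C / k) ^ p) * weightedMeasure ω q B := by
  have hpe0 : ENNReal.ofReal p ≠ 0 := by simpa using hp
  have hnorm : ∀ m : Measure (Cn N),
      eLpNorm (B.indicator (1 : Cn N → ℂ)) (ENNReal.ofReal p) m ^ p = m B := fun m => by
    have := eLpNorm_indicator_const (c := (1 : ℂ)) (μ := m) hB hpe0 ENNReal.ofReal_ne_top
    rw [show (B.indicator (1 : Cn N → ℂ)) = B.indicator fun _ => 1 from rfl, this, enorm_one,
      one_mul, ENNReal.toReal_ofReal hp.le, ← ENNReal.rpow_mul, one_div_mul_cancel hp.ne',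
      ENNReal.rpow_one]
  have h1 : eLpNorm (B.indicator (1 : Cn N → ℂ)) (ENNReal.ofReal p) (weightedMeasure ω Q) ≤
      ENNReal.ofReal k⁻¹ *
        eLpNorm (opP s t q (B.indicator 1)) (ENNReal.ofReal p) (weightedMeasure ω Q) := by
    refine eLpNorm_le_mul_eLpNorm_of_ae_le_mul
      ((weightedMeasure_absolutelyContinuous ω Q).ae_le ?_) _
    filter_upwards [hlow] with z hz
    by_cases hzB : z ∈ B
    · have hz := hz hzB
      rw [← ofReal_norm, ENNReal.ofReal_le_ofReal_iff (norm_nonneg _)] at hz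
      simp only [indicator_of_mem hzB, Pi.one_apply, norm_one]
      rw [inv_mul_eq_div, one_le_div hk]
      exact hz
    · simp only [indicator_of_notMem hzB, norm_zero]
      positivity
  have h2 := h1.trans (mul_le_mul_right hC _)
  have h3 := ENNReal.rpow_le_rpow h2 hp.le
  rw [hnorm, ← mul_assoc, ENNReal.mul_rpow_of_nonneg _ _ hp.le, hnorm, ← ENNReal.ofReal_coe_nnreal,
    ← ENNReal.ofReal_mul (by positivity), ENNReal.ofReal_rpow_of_nonneg (by positivity) hp.le,
    inv_mul_eq_div] at h3
  exact h3

/-- Continuity with `s + t > -1` forces `q ≤ Q`. -/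
theorem le_of_isWellDefinedContinuousP (hN : 1 ≤ N) {p s t q Q : ℝ} (hp : 1 < p)
    (hst : -1 < s + t) {ω : Cn N → ℝ} (hω : IsWeight ω)
    (h : IsWellDefinedContinuousP s t q Q p ω) : q ≤ Q := by
  by_contra! hQq
  have hp0 : 0 < p := by linarith
  have ha : -((N : ℝ) + 1) < s + t := by
    have : (0 : ℝ) ≤ N := N.cast_nonneg
    linarith
  let j₀ : Fin N := ⟨0, hN⟩
  obtain ⟨ε, hε, hest⟩ := exists_box_estimates hN j₀ ha
  obtain ⟨c, hc, hmu⟩ := exists_le_mu_box j₀ hε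
  obtain ⟨C, hC⟩ := h.continuous
  set k : ℝ := 2 ^ (-|t|) * 2 ^ (-|s|) * c / 2
  have hk : 0 < k := by positivity
  have key : ∀ d : ℝ, 0 < d → d ≤ 1 →
      2 ^ (-|Q|) * d ^ Q ≤ (C / k) ^ p * (2 ^ |q| * d ^ q) := by
    intro d hd hd1
    set r := √(1 - d)
    have hr0 : 0 ≤ r := Real.sqrt_nonneg _
    have hrd : 1 - r ^ 2 = d := by rw [Real.sq_sqrt (by linarith)]; ring
    have hr1 : r < 1 := by nlinarith
    obtain ⟨hker, hcomp⟩ := hest r hr0 hr1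
    have hmu := hmu r (by linarith)
    rw [hrd] at hker hcomp hmu
    set B := box j₀ ε r
    have hBo : IsOpen B := isOpen_box _ _ _
    have hB := hBo.measurableSet
    have hz₀ : EuclideanSpace.single j₀ (r : ℂ) ∈ B := single_mem_box j₀ hε (by linarith)
    have hρ : √(1 - d / 2) < 1 := by rw [Real.sqrt_lt' one_pos]; linarith
    have hBρ : B ⊆ closedBall 0 √(1 - d / 2) := fun z hz => by
      rw [mem_closedBall_zero_iff]
      exact Real.le_sqrt_of_sq_le (by linarith [(hcomp z hz).1])
    have hBu : B ⊆ unitBall N := hBρ.trans (closedBall_subset_ball hρ)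
    have hf : Measurable (B.indicator (1 : Cn N → ℂ)) := measurable_one.indicator hB
    have hfp := memLp_indicator_one hω (p := p) (q := q) hρ hB hBρ
    have hlow : ∀ᵐ z ∂(mu N), z ∈ B →
        ENNReal.ofReal k ≤ ‖opP s t q (B.indicator 1) z‖ₑ := by
      filter_upwards [h.wellDefined _ hf hfp] with z hint hz
      exact le_enorm_opP_indicator hd hB hc (hmu hBu) hker hcomp hz hint
    have hW := weightedMeasure_le_of_le_enorm_opP hp0 hB hk (hC _ hf hfp) hlow
    have hall := ((weightedMeasure_comparable hω Q hd hB hcomp).1.trans hW).trans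
      (mul_le_mul_right (weightedMeasure_comparable hω q hd hB hcomp).2 _)
    -- The mass of `ω` on `B` cancels, leaving an inequality between powers of `d` with constants
    -- independent of `d`.
    rw [← mul_assoc, ENNReal.mul_le_mul_iff_left
      (setLIntegral_weight_ne_zero hN hω h hBo hBu hz₀)
      (setLIntegral_weight_ne_top hω hρ hBρ), ← ENNReal.ofReal_mul (by positivity),
      ENNReal.ofReal_le_ofReal_iff (by positivity)] at hall
    exact hall
  -- `M` exceeds the constant allowed for `d ^ (Q - q)`, and `d = M ^ (-1 / (q - Q)) ≤ 1` attains `d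
  -- ^ (Q - q) = M`.
  set M : ℝ := (C / k) ^ p * 2 ^ |q| * 2 ^ |Q| + 1 with hM
  have hM1 : 1 ≤ M := by
    have : 0 ≤ (C / k) ^ p * 2 ^ |q| * (2 : ℝ) ^ |Q| := by positivity
    linarith
  have hM0 : 0 < M := by linarith
  have hd0 : 0 < M ^ (-(1 / (q - Q))) := by positivity
  have hqQ : 0 < q - Q := by linarith
  have hbound := key (M ^ (-(1 / (q - Q)))) hd0
    (Real.rpow_le_one_of_one_le_of_nonpos hM1 (by
      have : 0 < 1 / (q - Q) := by positivity
      linarith))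
  set d := M ^ (-(1 / (q - Q))) with hddef
  have hdM : d ^ (Q - q) = M := by
    rw [hddef, ← Real.rpow_mul hM0.le, show -(1 / (q - Q)) * (Q - q) = 1 by field_simp; ring,
      Real.rpow_one]
  have hdQ : d ^ Q = M * d ^ q := by
    rw [← hdM, ← Real.rpow_add hd0]; congr 1; ring
  have h2 : (2 : ℝ) ^ |Q| * 2 ^ (-|Q|) = 1 := by
    rw [← Real.rpow_add (by norm_num), add_neg_cancel, Real.rpow_zero]
  have hdq : 0 < d ^ q := by positivity
  have h4 := mul_le_mul_of_nonneg_left hbound (show (0 : ℝ) ≤ 2 ^ |Q| by positivity)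
  rw [← mul_assoc, h2, one_mul, hdQ] at h4
  nlinarith

end BergmanBesov

end

theorem mainTheorem6 (N : ℕ) (hN : 1 ≤ N) (p s t q Q : ℝ) (hp : 1 < p) (hs : -1 < s)
    (hregime : s + t + (Q - q) / p ≤ -1 ∨ (-1 < s + t ∧ Q < q)) :
    ¬ ∃ ω : BergmanBesov.Cn N → ℝ, BergmanBesov.IsWeight ω ∧
      BergmanBesov.IsWellDefinedContinuousP s t q Q p ω := by
  rintro ⟨ω, hω, h⟩
  rcases hregime with h1 | ⟨h1, h2⟩
  · exact absurd (BergmanBesov.neg_one_lt_of_isWellDefinedContinuousP hN hp hω h) (not_lt.2 h1)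
  · exact absurd (BergmanBesov.le_of_isWellDefinedContinuousP hN hp h1 hω h) (not_le.2 h2)
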